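/- **Programs.** A program $P$ consists of $n$ loop-free threads in guarded SSA form over a set of addresses and a set of values, and of a set of possible initial memories. Thread $i$ is a finite sequence of steps in program order. Each step is a read of an address, a write to an address, or a fence; it has an SSA symbol (for the value read or written) and a guard, a predicate on the values of the thread's symbols. A thread also has a constraint on the values of its symbols, a set of atomic load-store blocks (a read and a later write of the same address), and a set of assertions. An assertion has a set of steps (its reads), a guard and a condition; it is *reached* if its guard and the guards of its reads are true, and *violated* if moreover its condition is false. **Memory models.** Fix one of SC, TSO, PSO. For steps $a$ before $b$ of a thread write $a\prec b$ if $a$ must not be relaxed after $b$: always, except that TSO relaxes a write followed by a read of a different address, and PSO relaxes moreover a write followed by a write to a different address. (The preserved program order is generated by $\prec$; steps are not moved across fences.) An execution of $P$ gives values to all symbols that satisfy the constraints, chooses an allowed initial memory, and orders all steps with true guards (the executed steps) totally in a memory order such that: $a\prec b$ implies that $a$ precedes $b$; every read returns the value of the latest write to its address, of any thread, that precedes it, or the initial value if there is none; and no other write lies between the two parts of an executed atomic block. $P$ *has an assertion violation* if in some execution an assertion of some thread is reached and violated. **Event structures.** An event structure has a family of consistent sets of events (finite, closed under subsets), a relation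 $X\vdash e$ from consistent sets to events that is preserved when $X$ grows to a larger consistent set, and a labelling. A set $C$ is a *configuration* if it is consistent and secured, i.e. every $e\in C$ is the last member of a finite chain in $C$ each member of which is enabled by the set of the preceding ones; it is *maximal* if no configuration properly contains it. The structure $\Gamma_i$ of thread $i$ has these events: the writes; the reads from other threads; the local reads $(k,l)$ of a read $k$ from an earlier write $l$ of the same thread and address whose guard is compatible with that of $k$; the local reads of a read $k$ from the initial memory; the executed fences; and for each step the event that it is skipped (its guard is false). The label of a read or write event is its address. Two distinct events conflict if their guards cannot both be true (under the constraint), if they belong to the same step, or if one is a local read and the other a write to the same address that lies in program order before that read and after the write it reads. Consistent sets are the finite conflict-free ones. A skip is enabled by every consistent set; any other event of a step $b$ is enabled by $X$ iff for each $a\prec b$ an event of step $a$ is in $X$. Events of the product $\prod_i\Gamma_i$ are tuples with an event of $\Gamma_i$ or $*$ at each place $i$, not all $*$, whose events have equal labels. A finite set $X$ is consistent if its projections $\pi_iX$ are, no read from another thread occurs in two different tuples of $X$, and there are clocks $\mathrm{clk}_i$ on the events of $\Gamma_i$, strictly increasing along an enumeration without repetition of a consistent set containing $\pi_iX$ in which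 each event is enabled by the preceding ones, such that: a read has a larger clock than the write it is matched with; if a read reads the write $w$ (by matching or locally), every other write in $X$, of any thread, to the same address with a clock smaller than the read's has a clock smaller than that of $w$, and if it reads the initial memory there is no write to its address in $X$ with a smaller clock; distinct writes in $X$ to the same address have different clocks; and every write in $X$ other than that of an atomic block has a clock smaller than the block's read or larger than the block's write. $X\vdash m$ iff $X$ is consistent, a read from another thread in $m$ is accompanied by another event in $m$, and every event of $m$ is enabled by the projection of $X$. A *potential matches* relation $M$ is a set of tuples consisting of all tuples with a single event that is not a read from another thread, and of some tuples with two events, a read and a write of distinct threads, including all those for which the read gets its value from that write in some execution. Let $\Gamma_P$ be the restriction of $\prod_i\Gamma_i$ to $M$. A linearisation $\tau$ of a configuration $C$ of $\Gamma_P$ numbers the events of $C$ by $0,1,\dots$ so that each is enabled by those before it. It induces for each $i$ a partial map $\tau_i$ on the events of $\Gamma_i$: an event occurring in tuples of $C$ is sent to the first position of such a tuple. A data flow along $C$ consists of values of all symbols satisfying all constraints and an allowed initial memory, such that the steps executed in $C$ (those with an event other than a skip in $C$) are exactly those with true guards, and every read in $C$ has the value of the write, or the initial value, that it reads in $C$.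 With it, a set of events of $\Gamma_i$ contains the negation of an assertion of thread $i$ if all reads of the assertion are executed in the set, its guard is true and its condition is false. **Theorem.** For every program $P$, each of the memory models SC, TSO, PSO, and every potential matches relation $M$: $P$ has an assertion violation under the memory model if and only if $\Gamma_P$ has a maximal (secured) configuration $C$ for which there are a linearisation $\tau$, a data flow along $C$ and a thread $i$ such that $\tau_i$ restricted to $C$ (its domain) is a configuration of $\Gamma_i$ and contains, with this data flow, the negation of an assertion of thread $i$. -/

import Mathlib

/-! ## Event structures -/

/-- A (general, labelled) event structure on the set of events `E` with labels in `Lab`: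
consistent sets are finite and closed under subsets, the enabling relation relates consistent sets
to events and is extensive. -/
structure EventStructure (E Lab : Type*) where
  Con : Set E → Prop
  Enables : Set E → E → Prop
  label : E → Lab
  con_finite : ∀ X, Con X → X.Finite
  con_subset : ∀ X Y, X ⊆ Y → Con Y → Con X
  enables_con : ∀ X e, Enables X e → Con X
  enables_mono : ∀ X Y e, Enables X e → X ⊆ Y → Con Y → Enables Y e

namespace EventStructure

variable {E Lab : Type*}

/-- `C` is secured: every event of `C` is the last one of a finite chain of events of `C`, each of
which is enabled by the set of those before it. -/
def Secured (Γ : EventStructure E Lab) (C : Set E) : Prop :=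
  ∀ e ∈ C, ∃ (n : ℕ) (s : ℕ → E), s n = e ∧
    ∀ i ≤ n, s i ∈ C ∧ Γ.Enables (s '' Set.Iio i) (s i)

/-- Configurations: consistent secured sets of events. -/
def IsConfiguration (Γ : EventStructure E Lab) (C : Set E) : Prop :=
  Γ.Con C ∧ Γ.Secured C

/-- Configurations that cannot be extended by further events. -/
def IsMaximalConfiguration (Γ : EventStructure E Lab) (C : Set E) : Prop :=
  Γ.IsConfiguration C ∧ ∀ C', Γ.IsConfiguration C' → C ⊆ C' → C' = C

/-- `s` lists, without repetition, a consistent set of events in an order in which each event is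
enabled by its predecessors (a trace of the configuration `Set.range s`). -/
def IsSecuring (Γ : EventStructure E Lab) {N : ℕ} (s : Fin N → E) : Prop :=
  Function.Injective s ∧ Γ.Con (Set.range s) ∧ ∀ k, Γ.Enables (s '' Set.Iio k) (s k)

/-- `clk` is a clock order for the consistent set `X`: it strictly increases along a trace that
contains `X`. (A consistent set need not be secured itself, hence "contains".) -/
def IsClock (Γ : EventStructure E Lab) (X : Set E) (clk : E → ℕ) : Prop :=
  ∃ (N : ℕ) (s : Fin N → E), Γ.IsSecuring s ∧ X ⊆ Set.range s ∧ StrictMono (fun k => clk (s k))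

/-- The restriction of an event structure to a set `A` of its events. -/
def restrict (Γ : EventStructure E Lab) (A : Set E) : EventStructure A Lab where
  Con X := Γ.Con (Subtype.val '' X)
  Enables X e := Γ.Enables (Subtype.val '' X) e.1
  label e := Γ.label e.1
  con_finite _ h := (Γ.con_finite _ h).of_finite_image Subtype.val_injective.injOn
  con_subset _ _ hXY h := Γ.con_subset _ _ (Set.image_mono hXY) h
  enables_con _ _ h := Γ.enables_con _ _ h
  enables_mono _ _ _ h hXY hY := Γ.enables_mono _ _ _ h (Set.image_mono hXY) hY

/-- The clock structure: the natural numbers, `n` being enabled once `0, …, n - 1` have occurred. -/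
def clockStructure : EventStructure ℕ Unit where
  Con X := X.Finite
  Enables X n := X.Finite ∧ ∀ m < n, m ∈ X
  label _ := ()
  con_finite _ h := h
  con_subset _ _ hXY h := h.subset hXY
  enables_con _ _ h := h.1
  enables_mono _ _ _ h hXY hY := ⟨hY, fun m hm => hXY (h.2 m hm)⟩

/-- `τ` linearises `C` into the clock structure: it is defined exactly on `C`, injective, its
values form a consistent set of clock positions, and at every event `e` of `C` the events placed
before `e` enable `e`, while their positions enable the position of `e`. -/
structure IsLinearisation (Γ : EventStructure E Lab) (C : Set E) (τ : E → Option ℕ) : Prop where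
  dom : ∀ e, e ∈ C ↔ ∃ n, τ e = some n
  inj : ∀ e e' n, τ e = some n → τ e' = some n → e = e'
  con : clockStructure.Con {n | ∃ e, τ e = some n}
  enables : ∀ e n, τ e = some n → Γ.Enables {e' | ∃ m < n, τ e' = some m} e
  clock_enables : ∀ e n, τ e = some n →
    clockStructure.Enables {m | m < n ∧ ∃ e', τ e' = some m} n

end EventStructure

/-! ## Per-thread event structures with reads and writes, and their product -/

/-- The kinds of events of a thread: reads (which must synchronise with a write of another thread),
writes, local reads (which read `src`, a write of the same thread, or the initial write if `src` is
`none`), and control events (an executed fence, or a guard that was found to be false). -/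
inductive EventKind (E : Type*) where
  | read
  | write
  | localRead (src : Option E)
  | control

/-- An event structure together with the kinds of its events and the relation `block r w`: the read
or local read `r` and the write `w` form an atomic load-store block. -/
structure ThreadStructure (E Lab : Type*) extends EventStructure E Lab where
  kind : E → EventKind E
  block : E → E → Prop

/-- Events of the product: tuples with at least one entry different from `*` (that is, `none`)
whose entries have the same label. -/
structure ProductEvent {ι : Type*} {E : ι → Type*} {Lab : Type*}
    (Γ : ∀ i, ThreadStructure (E i) Lab) where
  comp : ∀ i, Option (E i)
  nonempty : ∃ i e, comp i = some e
  label_eq : ∀ i j e e', comp i = some e → comp j = some e' → (Γ i).label e = (Γ j).label e'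

section Product

variable {ι : Type*} {E : ι → Type*} {Lab : Type*} (Γ : ∀ i, ThreadStructure (E i) Lab)

/-- The projection of a set of product events to component `i`. -/
def proj (i : ι) (X : Set (ProductEvent Γ)) : Set (E i) :=
  {e | ∃ m ∈ X, m.comp i = some e}

/-- Consistency, in `X`, of the clocks of all threads. -/
structure ClocksConsistent (X : Set (ProductEvent Γ)) (clk : ∀ i, E i → ℕ) : Prop where
  /-- each thread uses a clock order of its own event structure -/
  clock : ∀ i, (Γ i).IsClock (proj Γ i X) (clk i)
  /-- a read follows the write that it reads -/
  no_time_travel : ∀ m ∈ X, ∀ i j r w, m.comp i = some r → (Γ i).kind r = .read →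
    m.comp j = some w → (Γ j).kind w = .write → clk j w < clk i r
  /-- a read reads the latest write, among the writes of all threads -/
  latest : ∀ m ∈ X, ∀ i j r w, m.comp i = some r → (Γ i).kind r = .read →
    m.comp j = some w → (Γ j).kind w = .write →
    ∀ k, ∀ w' ∈ proj Γ k X, (Γ k).kind w' = .write → (Γ k).label w' = (Γ i).label r →
      (⟨k, w'⟩ : Σ k, E k) ≠ ⟨j, w⟩ → clk k w' < clk i r → clk k w' < clk j w
  /-- a local read reads the latest write, among the writes of all threads -/
  local_latest : ∀ i, ∀ r ∈ proj Γ i X, ∀ w, (Γ i).kind r = .localRead (some w) →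
    ∀ k, ∀ w' ∈ proj Γ k X, (Γ k).kind w' = .write → (Γ k).label w' = (Γ i).label r →
      (⟨k, w'⟩ : Σ k, E k) ≠ ⟨i, w⟩ → clk k w' < clk i r → clk k w' < clk i w
  /-- a local read of the initial write precedes (or is level with) every write to its address -/
  init_latest : ∀ i, ∀ r ∈ proj Γ i X, (Γ i).kind r = .localRead none →
    ∀ k, ∀ w' ∈ proj Γ k X, (Γ k).kind w' = .write → (Γ k).label w' = (Γ i).label r →
      clk i r ≤ clk k w'
  /-- the writes to an address are totally ordered -/
  write_total : ∀ i j, ∀ w ∈ proj Γ i X, ∀ w' ∈ proj Γ j X,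
    (Γ i).kind w = .write → (Γ j).kind w' = .write → (Γ i).label w = (Γ j).label w' →
      (⟨i, w⟩ : Σ k, E k) ≠ ⟨j, w'⟩ → clk i w < clk j w' ∨ clk j w' < clk i w
  /-- no other write comes between the two parts of an atomic load-store block -/
  atomic : ∀ i, ∀ r ∈ proj Γ i X, ∀ w ∈ proj Γ i X, (Γ i).block r w →
    ∀ k, ∀ w' ∈ proj Γ k X, (Γ k).kind w' = .write → (⟨k, w'⟩ : Σ k, E k) ≠ ⟨i, w⟩ →
      clk k w' < clk i r ∨ clk i w < clk k w'

/-- Consistent sets of the product. -/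
structure ProductCon (X : Set (ProductEvent Γ)) : Prop where
  finite : X.Finite
  comp_con : ∀ i, (Γ i).Con (proj Γ i X)
  /-- the read events form a function -/
  functional : ∀ m ∈ X, ∀ m' ∈ X, ∀ i e, m.comp i = some e → m'.comp i = some e →
    (Γ i).kind e = .read → m = m'
  clocks : ∃ clk : ∀ i, E i → ℕ, ClocksConsistent Γ X clk

theorem proj_mono {i : ι} {X Y : Set (ProductEvent Γ)} (h : X ⊆ Y) : proj Γ i X ⊆ proj Γ i Y :=
  fun _ ⟨m, hm, he⟩ => ⟨m, h hm, he⟩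

theorem ProductCon.mono {X Y : Set (ProductEvent Γ)} (h : X ⊆ Y) (hY : ProductCon Γ Y) :
    ProductCon Γ X := by
  have hp : ∀ i, proj Γ i X ⊆ proj Γ i Y := fun i => proj_mono Γ h
  refine ⟨hY.finite.subset h, fun i => (Γ i).con_subset _ _ (hp i) (hY.comp_con i),
    fun m hm m' hm' => hY.functional m (h hm) m' (h hm'), ?_⟩
  obtain ⟨clk, hc⟩ := hY.clocks
  refine ⟨clk, ⟨fun i => ?_, fun m hm => hc.no_time_travel m (h hm), ?_, ?_, ?_, ?_, ?_⟩⟩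
  · obtain ⟨N, s, hs, hX, hmono⟩ := hc.clock i
    exact ⟨N, s, hs, (hp i).trans hX, hmono⟩
  · intro m hm i j r w h1 h2 h3 h4 k w' hw'
    exact hc.latest m (h hm) i j r w h1 h2 h3 h4 k w' (hp k hw')
  · intro i r hr w h1 k w' hw'
    exact hc.local_latest i r (hp i hr) w h1 k w' (hp k hw')
  · intro i r hr h1 k w' hw'
    exact hc.init_latest i r (hp i hr) h1 k w' (hp k hw')
  · intro i j w hw w' hw'
    exact hc.write_total i j w (hp i hw) w' (hp j hw')
  · intro i r hr w hw h1 k w' hw'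
    exact hc.atomic i r (hp i hr) w (hp i hw) h1 k w' (hp k hw')

/-- The product of the event structures `Γ i`. A tuple is enabled by `X` when the projections of
`X` enable all its entries, and a read occurs only together with another event. -/
noncomputable def productStructure : EventStructure (ProductEvent Γ) Lab where
  Con X := ProductCon Γ X
  Enables X m := ProductCon Γ X ∧
    (∀ i e, m.comp i = some e → (Γ i).kind e = .read → ∃ j, j ≠ i ∧ m.comp j ≠ none) ∧
    ∀ i e, m.comp i = some e → (Γ i).Enables (proj Γ i X) e
  label m := (Γ m.nonempty.choose).label m.nonempty.choose_spec.choose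
  con_finite _ h := h.finite
  con_subset _ _ hXY h := ProductCon.mono Γ hXY h
  enables_con _ _ h := h.1
  enables_mono _ _ _ h hXY hY := ⟨hY, h.2.1, fun i e he =>
    (Γ i).enables_mono _ _ _ (h.2.2 i e he) (proj_mono Γ hXY) (hY.comp_con i)⟩

/-- The tuple `m` consists of the single event `e` of thread `i`. -/
def ProductEvent.IsSingle {Γ : ∀ i, ThreadStructure (E i) Lab} (m : ProductEvent Γ) (i : ι)
    (e : E i) : Prop :=
  m.comp i = some e ∧ ∀ k, k ≠ i → m.comp k = none

/-- The tuple `m` consists of the event `r` of thread `i` and the event `w` of thread `j`. -/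
def ProductEvent.IsPair {Γ : ∀ i, ThreadStructure (E i) Lab} (m : ProductEvent Γ) (i : ι)
    (r : E i) (j : ι) (w : E j) : Prop :=
  i ≠ j ∧ m.comp i = some r ∧ m.comp j = some w ∧ ∀ k, k ≠ i → k ≠ j → m.comp k = none

end Product

/-! ## Programs in guarded static single assignment form -/

/-- The operation of a program step. -/
inductive MemOp (Loc : Type*) where
  | read (x : Loc)
  | write (x : Loc)
  | fence

namespace MemOp

/-- The address on which an operation acts, if any. -/
def loc? {Loc : Type*} : MemOp Loc → Option Loc
  | read x => some x
  | write x => some x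
  | fence => none

end MemOp

/-- An assertion of a thread: it is reached if its guard and the guards of its reads are true. -/
structure Assertion (len : ℕ) (Sym Val : Type*) where
  reads : Finset (Fin len)
  guard : (Sym → Val) → Prop
  holds : (Sym → Val) → Prop

/-- A (loop-free) thread in guarded SSA form: steps `0, …, len - 1` in program order, each with its
operation, the SSA symbol for the value it reads or writes, and its guard; the constraints `ssa` on
the symbols; the atomic load-store blocks (a load and a later store to the same address); and the
assertions. -/
structure Thread (Loc Val : Type*) where
  len : ℕ
  Sym : Type
  act : Fin len → MemOp Loc
  sym : Fin len → Sym
  guard : Fin len → (Sym → Val) → Prop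
  ssa : (Sym → Val) → Prop
  atomic : Fin len → Fin len → Prop
  atomic_spec : ∀ a b, atomic a b → a < b ∧ ∃ x, act a = .read x ∧ act b = .write x
  assertions : Set (Assertion len Sym Val)

/-- A shared memory program: `n` threads and the possible initial contents of the memory. -/
structure Program (Loc Val : Type*) where
  n : ℕ
  thread : Fin n → Thread Loc Val
  init : Set (Loc → Val)

/-- The memory models. -/
inductive MemoryModel where
  | sc
  | tso
  | pso

namespace Thread

variable {Loc Val : Type*}

/-- Step `a` precedes step `b` in program order and, by the memory model, must not be relaxed
after it. SC keeps the program order, TSO relaxes a write followed by a read of a different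
address, and PSO relaxes moreover a write followed by a write to a different address. Steps are
never moved across a fence. (The preserved program order is generated by these pairs.) -/
def Preserved (T : Thread Loc Val) (mm : MemoryModel) (a b : Fin T.len) : Prop :=
  a < b ∧
    match T.act a, T.act b with
    | .write x, .write y => mm = .sc ∨ mm = .tso ∨ x = y
    | .write x, .read y => mm = .sc ∨ x = y
    | _, _ => True

/-- The events of a thread: writes, reads from other threads, local reads from an earlier write
`l` of the thread, local reads from the initial write, executed fences, and, for every step, the
event that the step is skipped as its guard is false. -/
inductive Event (T : Thread Loc Val) : Type where
  | write (k : Fin T.len) (h : ∃ x, T.act k = .write x)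
  | read (k : Fin T.len) (h : ∃ x, T.act k = .read x)
  | localRead (k l : Fin T.len) (hlk : l < k)
      (h : ∃ x, T.act k = .read x ∧ T.act l = .write x)
      (hg : ∃ σ, T.ssa σ ∧ T.guard k σ ∧ T.guard l σ)
  | initRead (k : Fin T.len) (h : ∃ x, T.act k = .read x)
  | fence (k : Fin T.len) (h : T.act k = .fence)
  | skip (k : Fin T.len)

variable {T : Thread Loc Val}

namespace Event

/-- The step to which an event belongs. -/
def step : T.Event → Fin T.len
  | write k _ => k
  | read k _ => k
  | localRead k _ _ _ _ => k
  | initRead k _ => k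
  | fence k _ => k
  | skip k => k

/-- The event is an execution of its step. -/
def Executes : T.Event → Prop
  | skip _ => False
  | _ => True

/-- The guard of an event. -/
def guard : T.Event → (T.Sym → Val) → Prop
  | localRead k l _ _ _ => fun σ => T.guard k σ ∧ T.guard l σ
  | skip k => fun σ => ¬ T.guard k σ
  | e => T.guard e.step

/-- Labels are the addresses; control events have none. -/
def label : T.Event → Option Loc
  | skip _ => none
  | e => (T.act e.step).loc?

/-- The kind of an event. -/
def kind : T.Event → EventKind T.Event
  | write _ _ => .write
  | read _ _ => .read
  | localRead _ l _ h _ => .localRead (some (write l ⟨h.choose, h.choose_spec.2⟩))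
  | initRead _ _ => .localRead none
  | fence _ _ => .control
  | skip _ => .control

/-- The write `w` of the thread makes the local read `e` stale: it lies, in program order, between
`e` and the write that `e` reads, and acts on the same address. -/
def Stale : T.Event → T.Event → Prop
  | localRead k l _ _ _, write m _ =>
      l < m ∧ m < k ∧ (T.act m).loc? = (T.act k).loc?
  | initRead k _, write m _ => m < k ∧ (T.act m).loc? = (T.act k).loc?
  | _, _ => False

/-- The conflict relation of a thread: distinct events conflict if their guards cannot both be
true, if they belong to the same step, or if one is a local read made stale by the other. -/
def Conflict (e e' : T.Event) : Prop :=
  e ≠ e' ∧ ((¬ ∃ σ, T.ssa σ ∧ e.guard σ ∧ e'.guard σ) ∨ e.step = e'.step ∨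
    Stale e e' ∨ Stale e' e)

end Event

/-- Consistent sets of events of a thread: the finite conflict-free ones. -/
def Con (T : Thread Loc Val) (X : Set T.Event) : Prop :=
  X.Finite ∧ ∀ e ∈ X, ∀ e' ∈ X, ¬ e.Conflict e'

/-- The event structure of a thread. An execution of a step is enabled once every step that
precedes it in the preserved program order has been decided (executed or skipped). -/
def structureOf (T : Thread Loc Val) (mm : MemoryModel) :
    ThreadStructure T.Event (Option Loc) where
  Con := T.Con
  Enables X e := T.Con X ∧
    (e.Executes → ∀ a, T.Preserved mm a e.step → ∃ e' ∈ X, e'.step = a)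
  label := Event.label
  con_finite _ h := h.1
  con_subset _ _ hXY h := ⟨h.1.subset hXY, fun e he e' he' => h.2 e (hXY he) e' (hXY he')⟩
  enables_con _ _ h := h.1
  enables_mono _ _ _ h hXY hY := ⟨hY, fun he a ha =>
    let ⟨e', h1, h2⟩ := h.2 he a ha
    ⟨e', hXY h1, h2⟩⟩
  kind := Event.kind
  block e w := e.Executes ∧ w.Executes ∧ T.atomic e.step w.step

end Thread

/-! ## Executions under a memory model -/

namespace Program

variable {Loc Val : Type*}

/-- A candidate execution: values of all SSA symbols, the initial memory, the memory order (given
by time stamps), and, for reads, the write that is read (`none` is the initial write). -/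
structure Execution (P : Program Loc Val) where
  val : ∀ i, (P.thread i).Sym → Val
  ini : Loc → Val
  time : ∀ i, Fin (P.thread i).len → ℕ
  rf : ∀ i, Fin (P.thread i).len → Option (Σ j, Fin (P.thread j).len)

/-- Step `k` of thread `i` is executed: its guard is true. -/
def Execution.Exec {P : Program Loc Val} (X : P.Execution) (i : Fin P.n)
    (k : Fin (P.thread i).len) : Prop :=
  (P.thread i).guard k (X.val i)

/-- Step `k` of thread `i` is executed and is a write to `x`. -/
def Execution.ExecWrite {P : Program Loc Val} (X : P.Execution) (x : Loc) (i : Fin P.n)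
    (k : Fin (P.thread i).len) : Prop :=
  X.Exec i k ∧ (P.thread i).act k = .write x

/-- The axioms of an execution under the memory model `mm`. -/
structure Execution.Valid {P : Program Loc Val} (X : P.Execution) (mm : MemoryModel) : Prop where
  init : X.ini ∈ P.init
  ssa : ∀ i, (P.thread i).ssa (X.val i)
  /-- the memory order is total; in particular the writes to each address are serialised -/
  total : ∀ i j a b, X.Exec i a → X.Exec j b → X.time i a = X.time j b →
    (⟨i, a⟩ : Σ j, Fin (P.thread j).len) = ⟨j, b⟩
  /-- store order and load order (and fences), as the memory model requires -/
  order : ∀ i a b, X.Exec i a → X.Exec i b → (P.thread i).Preserved mm a b →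
    X.time i a < X.time i b
  /-- loads return the latest write -/
  value_write : ∀ i k x j w, X.Exec i k → (P.thread i).act k = .read x → X.rf i k = some ⟨j, w⟩ →
    X.ExecWrite x j w ∧ X.time j w < X.time i k ∧
    (∀ j' w', X.ExecWrite x j' w' → X.time j' w' < X.time i k → X.time j' w' ≤ X.time j w) ∧
    X.val i ((P.thread i).sym k) = X.val j ((P.thread j).sym w)
  /-- loads return the initial value if no write precedes them -/
  value_init : ∀ i k x, X.Exec i k → (P.thread i).act k = .read x → X.rf i k = none →
    (∀ j' w', X.ExecWrite x j' w' → ¬ X.time j' w' < X.time i k) ∧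
    X.val i ((P.thread i).sym k) = X.ini x
  /-- atomic load-store blocks are atomic with respect to other stores -/
  atomic : ∀ i a b, X.Exec i a → X.Exec i b → (P.thread i).atomic a b →
    ∀ j w x, X.ExecWrite x j w → (⟨j, w⟩ : Σ j, Fin (P.thread j).len) ≠ ⟨i, b⟩ →
      X.time j w < X.time i a ∨ X.time i b < X.time j w

/-- Some execution under `mm` reaches and violates an assertion of a thread. -/
def HasAssertionViolation (P : Program Loc Val) (mm : MemoryModel) : Prop :=
  ∃ X : P.Execution, X.Valid mm ∧ ∃ i, ∃ A ∈ (P.thread i).assertions,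
    (∀ k ∈ A.reads, X.Exec i k) ∧ A.guard (X.val i) ∧ ¬ A.holds (X.val i)

/-! ## The event structure semantics of a program -/

/-- The per-thread event structures. -/
def structures (P : Program Loc Val) (mm : MemoryModel) (i : Fin P.n) :
    ThreadStructure (P.thread i).Event (Option Loc) :=
  (P.thread i).structureOf mm

/-- `M` is a potential matches relation for `P`: it consists of single free events (all of them)
and of pairs of a read and a write in distinct threads (with the same address, as in any product
event), and over-approximates the possible communications: no pair of a read and a write where the
read gets its value from the write in an execution is missing. -/
structure IsPotentialMatches (P : Program Loc Val) (mm : MemoryModel)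
    (M : Set (ProductEvent (P.structures mm))) : Prop where
  shape : ∀ m ∈ M,
    (∃ i e, m.IsSingle i e ∧ e.kind ≠ .read) ∨
    (∃ i r j w, m.IsPair i r j w ∧ r.kind = .read ∧ w.kind = .write)
  free : ∀ m : ProductEvent (P.structures mm), ∀ i e, m.IsSingle i e → e.kind ≠ .read → m ∈ M
  complete : ∀ X : P.Execution, X.Valid mm → ∀ i k j l, X.Exec i k → X.rf i k = some ⟨j, l⟩ →
    ∀ (m : ProductEvent (P.structures mm)) hk hl,
      m.IsPair i (Thread.Event.read k hk) j (Thread.Event.write l hl) → m ∈ M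

/-- The semantics of `P`: the product of the per-thread event structures, restricted to the
potential matches. -/
noncomputable def semantics (P : Program Loc Val) (mm : MemoryModel)
    (M : Set (ProductEvent (P.structures mm))) : EventStructure M (Option Loc) :=
  (productStructure (P.structures mm)).restrict M

variable {P : Program Loc Val} {mm : MemoryModel} {M : Set (ProductEvent (P.structures mm))}

open Classical in
/-- The per-thread map of a linearisation `τ`: an event of thread `i` gets the (first) position of
a product event in which it takes part. -/
noncomputable def threadMap (τ : M → Option ℕ) (i : Fin P.n) (e : (P.thread i).Event) :
    Option ℕ :=
  if ∃ m n, m.1.comp i = some e ∧ τ m = some n then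
    some (sInf {n | ∃ m, m.1.comp i = some e ∧ τ m = some n})
  else none

/-- The events of thread `i` on which the restriction of the per-thread map to `C` is defined. -/
def threadEvents (τ : M → Option ℕ) (C : Set M) (i : Fin P.n) : Set (P.thread i).Event :=
  {e | (∃ m ∈ C, m.1.comp i = some e) ∧ ∃ n, threadMap τ i e = some n}

/-- The values `σ` of the SSA symbols and the initial memory `ini` are a data flow along `C`: they
satisfy the constraints of all threads, the steps executed in `C` are those whose guards are true,
and every read has the value of the write with which it is matched in `C`. -/
structure IsDataFlow (C : Set M) (σ : ∀ i, (P.thread i).Sym → Val) (ini : Loc → Val) : Prop where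
  init : ini ∈ P.init
  ssa : ∀ i, (P.thread i).ssa (σ i)
  guard : ∀ i k, (∃ m ∈ C, ∃ e, m.1.comp i = some e ∧ e.Executes ∧ e.step = k) ↔
    (P.thread i).guard k (σ i)
  read : ∀ m ∈ C, ∀ i j k l hk hl, m.1.comp i = some (.read k hk) →
    m.1.comp j = some (.write l hl) →
    σ i ((P.thread i).sym k) = σ j ((P.thread j).sym l)
  localRead : ∀ m ∈ C, ∀ i k l hlk h hg, m.1.comp i = some (.localRead k l hlk h hg) →
    σ i ((P.thread i).sym k) = σ i ((P.thread i).sym l)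
  initRead : ∀ m ∈ C, ∀ i k h x, m.1.comp i = some (.initRead k h) →
    (P.thread i).act k = .read x → σ i ((P.thread i).sym k) = ini x

/-- The set `S` of events of thread `i` contains, with the values `σ`, the negation of an
assertion: the assertion is reached in `S` and is false. -/
def ContainsNegatedAssertion (P : Program Loc Val) (i : Fin P.n) (S : Set (P.thread i).Event)
    (σ : (P.thread i).Sym → Val) : Prop :=
  ∃ A ∈ (P.thread i).assertions, (∀ k ∈ A.reads, ∃ e ∈ S, e.Executes ∧ e.step = k) ∧
    A.guard σ ∧ ¬ A.holds σ

end Program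

/-! Executions and configurations carry the same information, and the proof translates each into the
other.

From an execution to a configuration: every step is realised by exactly one event, determined by its
guard and by where it reads from (`Execution.exists_occurs`, `Execution.Occurs.eq_of_step`). The
tuples of `M` made of such events, with matches agreeing with reads-from, form the set
`Execution.tuples`. One numbering of the steps, `Execution.key`, puts the steps that are not
executed first and the others in memory order. It serves at once as the clock of every thread and,
via the step that owns a tuple, as the order that secures the tuples. The clock conditions then
become the axioms of a valid execution (`Execution.clocksConsistent_tuples`). The set is maximal
because every step is already decided and each read already has its partner
(`Execution.isMaximalConfiguration_tuples`).

From a configuration to an execution: the data flow supplies values and initial memory, the events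
supply reads-from, and the clocks supply the memory order. Clocks of different threads may coincide,
so they are refined to a total order in which a read precedes any write with the same clock, and
remaining ties are broken by thread index (`hasAssertionViolation_of_configuration`).

The memory models need no separate treatment: preserved order is simply transported between time
stamps and enabling, and beyond that the proof uses only that accesses of one thread to the same
address are never reordered, except between two reads, where nothing is needed. -/

namespace EventStructure

/-! ### Enumerations, securing sequences and linearisations -/

theorem exists_enumeration {E : Type*} {C : Set E} (hC : C.Finite) (key : E → ℕ)
    (hinj : C.InjOn key) :
    ∃ (N : ℕ) (s : Fin N → E), Set.range s = C ∧ StrictMono (fun k => key (s k)) := by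
  classical
  let F : Finset ℕ := (hC.image key).toFinset
  have hF : ∀ k : Fin F.card, ∃ e ∈ C, key e = F.orderEmbOfFin rfl k := fun k =>
    (Set.Finite.mem_toFinset (hC.image key)).1 (F.orderEmbOfFin_mem rfl k)
  choose s hs hkey using hF
  refine ⟨F.card, s, ?_, fun a b hab => ?_⟩
  · ext e
    refine ⟨?_, fun he => ?_⟩
    · rintro ⟨k, rfl⟩
      exact hs k
    · have hmem : key e ∈ (F : Set ℕ) := by simpa [F] using ⟨e, he, rfl⟩
      rw [← F.range_orderEmbOfFin rfl] at hmem
      obtain ⟨k, hk⟩ := hmem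
      exact ⟨k, hinj (hs k) he ((hkey k).trans hk)⟩
  · simpa only [hkey, OrderEmbedding.lt_iff_lt] using hab

variable {E Lab : Type*} {Γ : EventStructure E Lab}

/-- Sorting a finite set by an injective key turns "enabled by everything of smaller key" into
"enabled by its predecessors in the list". It is used both for single threads and for the product.
-/
theorem exists_isSecuring {C : Set E} (hC : Γ.Con C) (key : E → ℕ) (hinj : C.InjOn key)
    (hen : ∀ e ∈ C, Γ.Enables {e' | e' ∈ C ∧ key e' < key e} e) :
    ∃ (N : ℕ) (s : Fin N → E), Γ.IsSecuring s ∧ Set.range s = C ∧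
      StrictMono (fun k => key (s k)) := by
  obtain ⟨N, s, rfl, hmono⟩ := exists_enumeration (Γ.con_finite C hC) key hinj
  refine ⟨N, s, ⟨fun a b hab => hmono.injective (congrArg key hab), hC, fun k => ?_⟩, rfl, hmono⟩
  convert hen (s k) ⟨k, rfl⟩ using 1
  ext e
  constructor
  · rintro ⟨j, hj, rfl⟩
    exact ⟨⟨j, rfl⟩, hmono hj⟩
  · rintro ⟨⟨j, rfl⟩, hj⟩
    exact ⟨j, hmono.lt_iff_lt.1 hj, rfl⟩

theorem IsSecuring.secured {N : ℕ} {s : Fin N → E} (hs : Γ.IsSecuring s) :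
    Γ.Secured (Set.range s) := by
  rintro _ ⟨k, rfl⟩
  -- The value beyond `N` is a filler: the chain is only inspected up to `k < N`.
  refine ⟨k, fun i => if h : i < N then s ⟨i, h⟩ else s k, by simp, fun i hi => ?_⟩
  have hiN : i < N := hi.trans_lt k.2
  refine ⟨by simp [hiN], ?_⟩
  convert hs.2.2 ⟨i, hiN⟩ using 1
  · ext e
    constructor
    · rintro ⟨j, hj, rfl⟩
      have hjN : j < N := lt_trans hj hiN
      exact ⟨⟨j, hjN⟩, hj, by simp [hjN]⟩
    · rintro ⟨j, hj, rfl⟩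
      exact ⟨j, hj, by simp⟩
  · simp [hiN]

/-- Each event is sent to its index; the positions used form an initial segment of `ℕ`, which is
what the clock structure asks for. -/
theorem IsSecuring.exists_isLinearisation {N : ℕ} {s : Fin N → E} (hs : Γ.IsSecuring s) :
    ∃ τ, Γ.IsLinearisation (Set.range s) τ := by
  classical
  let τ : E → Option ℕ := fun e => if h : ∃ k, s k = e then some h.choose.1 else none
  have hτ : ∀ e n, τ e = some n ↔ ∃ k : Fin N, s k = e ∧ k.1 = n := by
    intro e n
    by_cases h : ∃ k, s k = e
    · simp only [τ, h, dif_pos, Option.some.injEq]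
      constructor
      · exact fun hn => ⟨h.choose, h.choose_spec, hn⟩
      · rintro ⟨k, hk, rfl⟩
        rw [hs.1 (h.choose_spec.trans hk.symm)]
    · simp only [τ, h, dif_neg, not_false_eq_true, reduceCtorEq, false_iff]
      exact fun ⟨k, hk, _⟩ => h ⟨k, hk⟩
  refine ⟨τ, ⟨fun e => ?_, ?_, ?_, ?_, ?_⟩⟩
  · simp [hτ]
  · simp only [hτ]
    rintro _ _ n ⟨k, rfl, rfl⟩ ⟨k', rfl, h⟩
    rw [Fin.ext h]
  · refine (Set.finite_Iio N).subset ?_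
    rintro n ⟨e, h⟩
    obtain ⟨k, -, rfl⟩ := (hτ _ _).1 h
    exact k.2
  · intro e n h
    obtain ⟨k, rfl, rfl⟩ := (hτ _ _).1 h
    convert hs.2.2 k using 1
    ext e
    simp only [hτ, Set.mem_ofPred_eq, Set.mem_image, Set.mem_Iio]
    constructor
    · rintro ⟨_, hm, j, rfl, rfl⟩
      exact ⟨j, hm, rfl⟩
    · rintro ⟨j, hj, rfl⟩
      exact ⟨j, hj, j, rfl, rfl⟩
  · intro e n h
    obtain ⟨k, rfl, rfl⟩ := (hτ _ _).1 h
    refine ⟨(Set.finite_Iio k.1).subset fun m hm => hm.1, fun m hm => ⟨hm, s ⟨m, hm.trans k.2⟩, ?_⟩⟩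
    exact (hτ _ _).2 ⟨_, rfl, rfl⟩

end EventStructure

/-! ### Events of an execution and the tuples that represent its steps -/

theorem ProductEvent.ext_comp {ι : Type*} {E : ι → Type*} {Lab : Type*}
    {Γ : ∀ i, ThreadStructure (E i) Lab} {m m' : ProductEvent Γ}
    (h : ∀ i, m.comp i = m'.comp i) : m = m' := by
  cases m
  cases m'
  congr
  exact funext h

namespace Program

variable {Loc Val : Type*} {P : Program Loc Val} {mm : MemoryModel}
  {M : Set (ProductEvent (P.structures mm))}

open Thread (Event)

/-- The event `e` of thread `i` takes place in the execution `X`. -/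
def Execution.Occurs (X : P.Execution) (i : Fin P.n) : (P.thread i).Event → Prop
  | .write k _ => X.Exec i k
  | .read k _ => X.Exec i k ∧ ∃ j l, j ≠ i ∧ X.rf i k = some ⟨j, l⟩
  | .localRead k l _ _ _ => X.Exec i k ∧ X.rf i k = some ⟨i, l⟩
  | .initRead k _ => X.Exec i k ∧ X.rf i k = none
  | .fence k _ => X.Exec i k
  | .skip k => ¬ X.Exec i k

/-- The tuple `m` represents step `p.2` of thread `p.1`: as a single event, or as the read of a
matched pair. -/
def Owns (p : Σ i, Fin (P.thread i).len) (m : ProductEvent (P.structures mm)) : Prop :=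
  (∃ e : (P.thread p.1).Event, m.IsSingle p.1 e ∧ e.kind ≠ .read ∧ e.step = p.2) ∨
  ∃ (h : _) (j : Fin P.n) (l : Fin (P.thread j).len) (hl : _),
    m.IsPair p.1 (Event.read p.2 h) j (Event.write l hl)

theorem exists_owns (hM : P.IsPotentialMatches mm M) {m : ProductEvent (P.structures mm)}
    (hm : m ∈ M) : ∃ p, Owns p m := by
  obtain ⟨i, e, he, hk⟩ | ⟨i, r, j, w, hp, hr, hw⟩ := hM.shape m hm
  · exact ⟨⟨i, e.step⟩, Or.inl ⟨e, he, hk, rfl⟩⟩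
  · cases r <;> simp only [Event.kind, reduceCtorEq] at hr
    cases w <;> simp only [Event.kind, reduceCtorEq] at hw
    exact ⟨⟨i, _⟩, Or.inr ⟨_, j, _, _, hp⟩⟩

theorem Owns.exists_comp {p : Σ i, Fin (P.thread i).len} {m : ProductEvent (P.structures mm)}
    (h : Owns p m) : ∃ e : (P.thread p.1).Event, m.comp p.1 = some e ∧ e.step = p.2 := by
  obtain ⟨e, he, -, hs⟩ | ⟨h, j, l, hl, hp⟩ := h
  · exact ⟨e, he.1, hs⟩
  · exact ⟨_, hp.2.1, rfl⟩

/-- A single tuple has only one thread to offer, and in a pair only the read can be an owner,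
because the other entry is a write. -/
theorem Owns.unique {p q : Σ i, Fin (P.thread i).len} {m : ProductEvent (P.structures mm)}
    (hp : Owns p m) (hq : Owns q m) : p = q := by
  have key : p.1 = q.1 := by
    by_contra hne
    obtain ⟨e, he, -⟩ := hp.exists_comp
    obtain ⟨f, hf, -⟩ := hq.exists_comp
    obtain ⟨_, h, -⟩ | ⟨_, j, l, hl, h⟩ := hp
    · simp [h.2 _ (Ne.symm hne)] at hf
    · obtain ⟨_, h', -⟩ | ⟨_, j', l', hl', h'⟩ := hq
      · simp [h'.2 _ hne] at he
      · have hj : q.1 = j := by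
          by_contra hj
          simp [h.2.2.2 _ (Ne.symm hne) hj] at hf
        obtain ⟨i, k⟩ := q
        subst hj
        have := h.2.2.1.symm.trans h'.2.1
        simp at this
  obtain ⟨e, he, hep⟩ := hp.exists_comp
  obtain ⟨f, hf, hfq⟩ := hq.exists_comp
  obtain ⟨i, k⟩ := p
  obtain ⟨j, l⟩ := q
  obtain rfl : i = j := key
  obtain rfl : e = f := Option.some.inj (he.symm.trans hf)
  exact congrArg _ (hep.symm.trans hfq)

namespace Execution

variable {X : P.Execution}

theorem Occurs.exec_iff {i : Fin P.n} {e : (P.thread i).Event} (h : X.Occurs i e) :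
    X.Exec i e.step ↔ e.Executes := by
  cases e <;> simp_all [Occurs, Event.step, Event.Executes]

/-- The operation, the truth of the guard and the value of `rf` (no write, a write of the same
thread, a write of another thread) single out one kind of event, and `rf` also fixes the source of a
local read. -/
theorem Occurs.eq_of_step {i : Fin P.n} {e e' : (P.thread i).Event} (h : X.Occurs i e)
    (h' : X.Occurs i e') (hs : e.step = e'.step) : e = e' := by
  cases e <;> cases e' <;> simp only [Event.step] at hs <;> subst hs <;>
    simp_all [Occurs]
  all_goals grind

/-- Every step of an execution is represented by the tuple of an event that takes place. -/
theorem exists_occurs (hX : X.Valid mm) (hM : P.IsPotentialMatches mm M)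
    (p : Σ i, Fin (P.thread i).len) :
    ∃ m ∈ M, Owns p m ∧ (∀ i e, m.comp i = some e → X.Occurs i e) ∧
      ∀ i k hk j l hl, m.comp i = some (Event.read k hk) → m.comp j = some (Event.write l hl) →
        X.rf i k = some ⟨j, l⟩ := by
  classical
  obtain ⟨i, k⟩ := p
  have single : ∀ e : (P.thread i).Event, X.Occurs i e → e.kind ≠ .read → e.step = k →
      ∃ m ∈ M, Owns ⟨i, k⟩ m ∧ (∀ i e, m.comp i = some e → X.Occurs i e) ∧
      ∀ i k hk j l hl, m.comp i = some (Event.read k hk) → m.comp j = some (Event.write l hl) →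
        X.rf i k = some ⟨j, l⟩ := by
    intro e he hk hs
    let c : ∀ j, Option (P.thread j).Event := Function.update (fun _ => none) i (some e)
    have hc : ∀ j f, c j = some f → (⟨i, e⟩ : Σ j, (P.thread j).Event) = ⟨j, f⟩ := by
      intro j f hf
      by_cases hj : j = i
      · subst hj
        simp only [c, Function.update_self, Option.some.injEq] at hf
        rw [hf]
      · simp [c, hj] at hf
    let m : ProductEvent (P.structures mm) :=
      ⟨c, ⟨i, e, by simp [c]⟩, fun j j' f f' hf hf' => by
        cases (hc _ _ hf); cases (hc _ _ hf'); rfl⟩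
    have hm : m.IsSingle i e := ⟨by simp [m, c], fun j hj => by simp [m, c, hj]⟩
    refine ⟨m, hM.free m i e hm hk, Or.inl ⟨e, hm, hk, hs⟩, ?_, ?_⟩
    · intro j f hf
      cases (hc _ _ hf)
      exact he
    · intro j k' hk' j' l hl hr
      cases (hc _ _ hr)
      exact absurd rfl hk
  by_cases hex : X.Exec i k
  swap
  · exact single (.skip k) hex (by simp [Event.kind]) rfl
  cases hact : (P.thread i).act k with
  | write x => exact single (.write k ⟨x, hact⟩) hex (by simp [Event.kind]) rfl
  | fence => exact single (.fence k hact) hex (by simp [Event.kind]) rfl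
  | read x =>
    cases hrf : X.rf i k with
    | none => exact single (.initRead k ⟨x, hact⟩) ⟨hex, hrf⟩ (by simp [Event.kind]) rfl
    | some q =>
      obtain ⟨j, l⟩ := q
      obtain ⟨hw, hlt, -, -⟩ := hX.value_write i k x j l hex hact hrf
      by_cases hj : j = i
      · subst hj
        have hlk : l < k := by
          by_contra hlk
          have hne : l ≠ k := fun h => by subst h; exact lt_irrefl _ hlt
          have hkl : k < l := lt_of_le_of_ne (not_lt.1 hlk) hne.symm
          -- A read followed by a write is preserved in every model, so a thread cannot read from
          -- its own later write.
          exact lt_asymm hlt (hX.order j k l hex hw.1 ⟨hkl, by simp [hact, hw.2]⟩)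
        exact single (.localRead k l hlk ⟨x, hact, hw.2⟩ ⟨X.val j, hX.ssa j, hex, hw.1⟩)
          ⟨hex, hrf⟩ (by simp [Event.kind]) rfl
      · let r : (P.thread i).Event := .read k ⟨x, hact⟩
        let w : (P.thread j).Event := .write l ⟨x, hw.2⟩
        let c : ∀ j, Option (P.thread j).Event :=
          Function.update (Function.update (fun _ => none) i (some r)) j (some w)
        have hc : ∀ j' f, c j' = some f → (⟨i, r⟩ : Σ j, (P.thread j).Event) = ⟨j', f⟩ ∨
            (⟨j, w⟩ : Σ j, (P.thread j).Event) = ⟨j', f⟩ := by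
          intro j' f hf
          by_cases hj' : j' = j
          · subst hj'
            simp only [c, Function.update_self, Option.some.injEq] at hf
            exact Or.inr (by rw [hf])
          · by_cases hi' : j' = i
            · subst hi'
              simp only [c, ne_eq, hj', not_false_eq_true, Function.update_of_ne,
                Function.update_self, Option.some.injEq] at hf
              exact Or.inl (by rw [hf])
            · simp [c, hj', hi'] at hf
        have hr : r.label = some x := by simp [r, Event.label, Event.step, hact, MemOp.loc?]
        have hwl : w.label = some x := by simp [w, Event.label, Event.step, hw.2, MemOp.loc?]
        have hlab : ∀ j' f, c j' = some f → f.label = some x := by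
          intro j' f hf
          obtain h | h := hc _ _ hf
          · cases h; exact hr
          · cases h; exact hwl
        let m : ProductEvent (P.structures mm) :=
          ⟨c, ⟨j, w, by simp [c]⟩, fun a b f f' hf hf' =>
            (hlab _ _ hf).trans (hlab _ _ hf').symm⟩
        have hm : m.IsPair i r j w := by
          refine ⟨fun h => hj h.symm, ?_, by simp [m, c], fun a ha hb => by simp [m, c, ha, hb]⟩
          simp [m, c, Ne.symm hj]
        refine ⟨m, hM.complete X hX i k j l hex hrf m _ _ hm, Or.inr ⟨_, j, l, _, hm⟩, ?_, ?_⟩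
        · intro j' f hf
          obtain h | h := hc _ _ hf
          · cases h; exact ⟨hex, j, l, hj, hrf⟩
          · cases h; exact hw.1
        · intro i' k' hk' j' l' hl' h1 h2
          dsimp only [r, w] at hc
          obtain h | h := hc _ _ h1
          · cases h
            obtain h | h := hc _ _ h2
            · cases h
            · cases h; exact hrf
          · cases h

/-- The values of the execution make all guards of occurring events true together. A stale local
read is impossible: same-address order is preserved, so the intervening write would be a later write
visible to the read. -/
theorem not_conflict (hX : X.Valid mm) {i : Fin P.n} {e e' : (P.thread i).Event}
    (h : X.Occurs i e) (h' : X.Occurs i e') : ¬ e.Conflict e' := by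
  have guard : ∀ e : (P.thread i).Event, X.Occurs i e → e.guard (X.val i) := by
    intro e he
    cases e <;> simp only [Occurs] at he
    case localRead k l hlk hx hg =>
      obtain ⟨x, hk, hl⟩ := hx
      exact ⟨he.1, (hX.value_write i k x i l he.1 hk he.2).1.1⟩
    all_goals first | exact he | exact he.1
  have stale : ∀ e e' : (P.thread i).Event, X.Occurs i e → X.Occurs i e' → ¬ e.Stale e' := by
    intro e e' he he'
    cases e <;> cases e' <;> simp only [Event.Stale, not_false_eq_true]
    case localRead.write k l hlk hx hg m hm =>
      rintro ⟨hlm, hmk, hloc⟩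
      obtain ⟨x, hk, hl⟩ := hx
      obtain ⟨y, hm⟩ := hm
      obtain rfl : y = x := by simpa [hk, hm, MemOp.loc?] using hloc
      obtain ⟨hw, hlt, hlast, -⟩ := hX.value_write i k y i l he.1 hk he.2
      have h1 := hX.order i l m hw.1 he' ⟨hlm, by simp [hl, hm]⟩
      have h2 := hX.order i m k he' he.1 ⟨hmk, by simp [hk, hm]⟩
      exact absurd (hlast i m ⟨he', hm⟩ h2) (not_le.2 h1)
    case initRead.write k hx m hm =>
      rintro ⟨hmk, hloc⟩
      obtain ⟨x, hk⟩ := hx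
      obtain ⟨y, hm⟩ := hm
      obtain rfl : y = x := by simpa [hk, hm, MemOp.loc?] using hloc
      exact (hX.value_init i k y he.1 hk he.2).1 i m ⟨he', hm⟩
        (hX.order i m k he' he.1 ⟨hmk, by simp [hk, hm]⟩)
  rintro ⟨hne, hg | hs | hs | hs⟩
  · exact hg ⟨X.val i, hX.ssa i, guard e h, guard e' h'⟩
  · exact hne (h.eq_of_step h' hs)
  · exact stale e e' h h' hs
  · exact stale e' e h' h hs

open Classical in
/-- A key that orders the steps of an execution: first those that are not executed, then the
others in memory order. -/
noncomputable def key (X : P.Execution) (i : Fin P.n) (k : Fin (P.thread i).len) : ℕ :=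
  if X.Exec i k then Fintype.card (Σ i, Fin (P.thread i).len) + X.time i k
  else Fintype.equivFin (Σ i, Fin (P.thread i).len) ⟨i, k⟩

theorem key_lt_key {i j : Fin P.n} {k : Fin (P.thread i).len} {l : Fin (P.thread j).len}
    (hk : X.Exec i k) (hl : X.Exec j l) : X.key i k < X.key j l ↔ X.time i k < X.time j l := by
  simp [key, hk, hl]

/-- The offset by the number of steps keeps all executed steps above the numbering of the others. -/
theorem key_lt_key_of_not_exec {i j : Fin P.n} {k : Fin (P.thread i).len}
    {l : Fin (P.thread j).len} (hk : ¬ X.Exec i k) (hl : X.Exec j l) :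
    X.key i k < X.key j l := by
  simp only [key, hk, hl, if_true, if_false]
  exact Nat.lt_add_right _ (Fin.is_lt _)

theorem key_inj (hX : X.Valid mm) {p q : Σ i, Fin (P.thread i).len}
    (h : X.key p.1 p.2 = X.key q.1 q.2) : p = q := by
  by_cases hp : X.Exec p.1 p.2 <;> by_cases hq : X.Exec q.1 q.2
  · exact hX.total p.1 q.1 p.2 q.2 hp hq (by simpa [key, hp, hq] using h)
  · exact absurd h (key_lt_key_of_not_exec hq hp).ne'
  · exact absurd h (key_lt_key_of_not_exec hp hq).ne
  · simp only [key, hp, hq, if_false] at h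
    exact (Fintype.equivFin _).injective (Fin.ext h)

/-- Enabling asks that a predecessor be decided, possibly by a skip. Skips have no prerequisites, so
placing them first covers that case; the order axiom covers executed predecessors. -/
theorem key_lt_of_preserved (hX : X.Valid mm) {i : Fin P.n} {a b : Fin (P.thread i).len}
    (hb : X.Exec i b) (hab : (P.thread i).Preserved mm a b) : X.key i a < X.key i b := by
  by_cases ha : X.Exec i a
  · exact (key_lt_key ha hb).2 (hX.order i a b ha hb hab)
  · exact key_lt_key_of_not_exec ha hb

end Execution

end Program

/-! ### The maximal configuration of an execution -/

namespace Program

variable {Loc Val : Type*} {P : Program Loc Val} {mm : MemoryModel}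
  {M : Set (ProductEvent (P.structures mm))}

open Thread (Event)

namespace Execution

variable {X : P.Execution}

/-- The tuples of `M` that take place in an execution. -/
def tuples (X : P.Execution) (M : Set (ProductEvent (P.structures mm))) : Set M :=
  {m | (∀ i e, m.1.comp i = some e → X.Occurs i e) ∧
    ∀ i k hk j l hl, m.1.comp i = some (Event.read k hk) →
      m.1.comp j = some (Event.write l hl) → X.rf i k = some ⟨j, l⟩}

theorem exists_mem_tuples (hX : X.Valid mm) (hM : P.IsPotentialMatches mm M)
    (p : Σ i, Fin (P.thread i).len) : ∃ m ∈ X.tuples M, Owns p m.1 := by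
  obtain ⟨m, hm, ho, h1, h2⟩ := exists_occurs hX hM p
  exact ⟨⟨m, hm⟩, ⟨h1, h2⟩, ho⟩

theorem Occurs.exists_mem_tuples (hX : X.Valid mm) (hM : P.IsPotentialMatches mm M) {i : Fin P.n}
    {e : (P.thread i).Event} (he : X.Occurs i e) :
    ∃ m ∈ X.tuples M, m.1.comp i = some e ∧ Owns ⟨i, e.step⟩ m.1 := by
  obtain ⟨m, hm, ho⟩ := Execution.exists_mem_tuples hX hM ⟨i, e.step⟩
  obtain ⟨e', he', hs⟩ := ho.exists_comp
  exact ⟨m, hm, (hm.1 i e' he').eq_of_step he hs ▸ he', ho⟩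

theorem proj_tuples (hX : X.Valid mm) (hM : P.IsPotentialMatches mm M) (i : Fin P.n) :
    proj (P.structures mm) i (Subtype.val '' X.tuples M) = {e | X.Occurs i e} := by
  ext e
  constructor
  · rintro ⟨_, ⟨m, hm, rfl⟩, he⟩
    exact hm.1 i e he
  · intro he
    obtain ⟨m, hm, hme, -⟩ := Occurs.exists_mem_tuples hX hM he
    exact ⟨m.1, ⟨m, hm, rfl⟩, hme⟩

/-- The owning step determines its event, and for a pair `rf` determines the partner. Thus owners
index the tuples of an execution injectively. -/
theorem eq_of_owns {m m' : M} (hm : m ∈ X.tuples M) (hm' : m' ∈ X.tuples M)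
    {p : Σ i, Fin (P.thread i).len} (h : Owns p m.1) (h' : Owns p m'.1) : m = m' := by
  obtain ⟨e, he, hep⟩ := h.exists_comp
  obtain ⟨e', he', hep'⟩ := h'.exists_comp
  obtain rfl := (hm.1 _ _ he).eq_of_step (hm'.1 _ _ he') (hep.trans hep'.symm)
  refine Subtype.ext (ProductEvent.ext_comp fun i => ?_)
  obtain ⟨f, hf, hk, -⟩ | ⟨hr, j, l, hl, hp⟩ := h <;>
    obtain ⟨f', hf', hk', -⟩ | ⟨hr', j', l', hl', hp'⟩ := h'
  · by_cases hi : i = p.1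
    · subst hi
      rw [he, he']
    · rw [hf.2 i hi, hf'.2 i hi]
  · obtain rfl := Option.some.inj (he.symm.trans hf.1)
    obtain rfl := Option.some.inj (he'.symm.trans hp'.2.1)
    exact absurd rfl hk
  · obtain rfl := Option.some.inj (he'.symm.trans hf'.1)
    obtain rfl := Option.some.inj (he.symm.trans hp.2.1)
    exact absurd rfl hk'
  · have h1 := hm.2 _ _ _ _ _ _ hp.2.1 hp.2.2.1
    have h2 := hm'.2 _ _ _ _ _ _ hp'.2.1 hp'.2.2.1
    cases h1.symm.trans h2
    by_cases hi : i = p.1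
    · subst hi
      rw [he, he']
    · by_cases hj : i = j
      · subst hj
        rw [hp.2.2.1, hp'.2.2.1]
      · rw [hp.2.2.2 i hi hj, hp'.2.2.2 i hi hj]

theorem con_occurs (hX : X.Valid mm) (i : Fin P.n) :
    (P.thread i).Con {e | X.Occurs i e} :=
  ⟨Set.Finite.of_injOn (f := Event.step) (t := Set.univ) (fun _ _ => trivial)
    (fun _ he _ he' hs => Occurs.eq_of_step he he' hs) Set.finite_univ,
    fun _ he _ he' => not_conflict hX he he'⟩

theorem exists_thread_enumeration (hX : X.Valid mm) (hM : P.IsPotentialMatches mm M)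
    (i : Fin P.n) : ∃ (N : ℕ) (s : Fin N → (P.thread i).Event),
      (P.structures mm i).IsSecuring s ∧ Set.range s = {e | X.Occurs i e} ∧
      StrictMono (fun k => X.key i (s k).step) := by
  refine EventStructure.exists_isSecuring (Γ := (P.structures mm i).toEventStructure)
    (con_occurs hX i) (fun e => X.key i e.step) ?_ ?_
  · intro e he e' he' h
    have := key_inj hX (p := ⟨i, e.step⟩) (q := ⟨i, e'.step⟩) h
    exact Occurs.eq_of_step he he' (by simpa using this)
  · intro e he
    refine ⟨(P.structures mm i).con_subset _ _ (fun _ h => h.1) (con_occurs hX i), ?_⟩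
    intro hex a ha
    obtain ⟨m, hm, ho⟩ := Execution.exists_mem_tuples hX hM ⟨i, a⟩
    obtain ⟨e', he', hs⟩ := ho.exists_comp
    refine ⟨e', ⟨hm.1 i e' he', ?_⟩, hs⟩
    change e'.step = a at hs
    change X.key i e'.step < _
    rw [hs]
    exact key_lt_of_preserved hX (he.exec_iff.2 hex) ha

theorem Occurs.exec_of_write {i : Fin P.n} {e : (P.thread i).Event} (he : X.Occurs i e)
    (hk : (P.structures mm i).kind e = .write) {o : Option Loc}
    (hl : (P.structures mm i).label e = o) :
    ∃ x h, e = Event.write e.step h ∧ o = some x ∧ X.ExecWrite x i e.step := by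
  cases e <;> simp only [structures, Thread.structureOf, Event.kind, reduceCtorEq] at hk
  rename_i k h
  obtain ⟨x, hx⟩ := h
  refine ⟨x, ⟨x, hx⟩, rfl, ?_, he, hx⟩
  rw [← hl]
  simp [structures, Thread.structureOf, Event.label, Event.step, hx, MemOp.loc?]

theorem clocksConsistent_tuples (hX : X.Valid mm) (hM : P.IsPotentialMatches mm M) :
    ClocksConsistent (P.structures mm) (Subtype.val '' X.tuples M)
      (fun i e => X.key i e.step) := by
  have hp := proj_tuples hX hM
  have read_write : ∀ m ∈ Subtype.val '' X.tuples M, ∀ i j r w, m.comp i = some r →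
      (P.structures mm i).kind r = .read → m.comp j = some w →
      (P.structures mm j).kind w = .write →
      ∃ x, (P.structures mm i).label r = some x ∧ X.Exec i r.step ∧
        (P.thread i).act r.step = .read x ∧ X.rf i r.step = some ⟨j, w.step⟩ ∧
        ∃ h, w = Event.write w.step h := by
    rintro _ ⟨m, hm, rfl⟩ i j r w hr hrk hw hwk
    cases r <;> simp only [structures, Thread.structureOf, Event.kind, reduceCtorEq] at hrk
    cases w <;> simp only [structures, Thread.structureOf, Event.kind, reduceCtorEq] at hwk
    rename_i k hk l hl
    obtain ⟨x, hx⟩ := id hk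
    refine ⟨x, ?_, (hm.1 i _ hr).1, hx, hm.2 _ _ _ _ _ _ hr hw, hl, rfl⟩
    simp [structures, Thread.structureOf, Event.label, Event.step, hx, MemOp.loc?]
  refine ⟨fun i => ?_, ?_, ?_, ?_, ?_, ?_, ?_⟩
  · obtain ⟨N, s, hs, hr, hmono⟩ := exists_thread_enumeration hX hM i
    exact ⟨N, s, hs, by rw [hp, hr], hmono⟩
  · intro m hm i j r w hr hrk hw hwk
    obtain ⟨x, -, hex, hact, hrf, -⟩ := read_write m hm i j r w hr hrk hw hwk
    obtain ⟨h1, h2, -⟩ := hX.value_write i _ x j _ hex hact hrf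
    exact (key_lt_key h1.1 hex).2 h2
  · intro m hm i j r w hr hrk hw hwk k w' hw' hwk' hl hne hlt
    obtain ⟨x, hx, hex, hact, hrf, hh, hwe⟩ := read_write m hm i j r w hr hrk hw hwk
    obtain ⟨h1, h2, h3, -⟩ := hX.value_write i _ x j _ hex hact hrf
    rw [hp] at hw'
    obtain ⟨y, hh', hwe', hy, h4⟩ := hw'.exec_of_write hwk' (hl.trans hx)
    cases hy
    -- Validity only bounds `w'` weakly by the write read; equality of times would identify the two
    -- writes, against `hne`.
    refine (key_lt_key h4.1 h1.1).2 (lt_of_le_of_ne (h3 _ _ h4 ((key_lt_key h4.1 hex).1 hlt)) ?_)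
    intro heq
    have h5 := hX.total _ _ _ _ h4.1 h1.1 heq
    refine hne ?_
    obtain ⟨rfl, h6⟩ := Sigma.mk.inj_iff.1 h5
    rw [hw'.eq_of_step (X := X) (by obtain ⟨m, hm, rfl⟩ := hm; exact hm.1 _ _ hw) (eq_of_heq h6)]
  · intro i r hr w hrk k w' hw' hwk' hl hne hlt
    rw [hp] at hr hw'
    cases r <;> simp only [structures, Thread.structureOf, Event.kind, reduceCtorEq,
      EventKind.localRead.injEq, Option.some.injEq] at hrk
    rename_i a b hab h hg
    obtain ⟨x, ha, hb⟩ := id h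
    subst hrk
    obtain ⟨hex, hrf⟩ := hr
    obtain ⟨h1, h2, h3, -⟩ := hX.value_write i _ x i _ hex ha hrf
    obtain ⟨y, hh', hwe', hy, h4⟩ := hw'.exec_of_write hwk' hl
    have hxy : y = x := by
      simpa [structures, Thread.structureOf, Event.label, Event.step, ha, MemOp.loc?] using hy.symm
    subst hxy
    refine (key_lt_key h4.1 h1.1).2 (lt_of_le_of_ne (h3 _ _ h4 ((key_lt_key h4.1 hex).1 hlt)) ?_)
    intro heq
    have h5 := hX.total _ _ _ _ h4.1 h1.1 heq
    refine hne ?_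
    obtain ⟨rfl, h6⟩ := Sigma.mk.inj_iff.1 h5
    rw [hw'.eq_of_step (X := X) (e' := Event.write b ⟨y, hb⟩) h1.1 (eq_of_heq h6)]
  · intro i r hr hrk k w' hw' hwk' hl
    rw [hp] at hr hw'
    cases r <;> simp only [structures, Thread.structureOf, Event.kind, reduceCtorEq,
      EventKind.localRead.injEq] at hrk
    rename_i a h
    obtain ⟨x, ha⟩ := id h
    obtain ⟨hex, hrf⟩ := hr
    obtain ⟨y, hh', hwe', hy, h4⟩ := hw'.exec_of_write hwk' hl
    have hxy : y = x := by
      simpa [structures, Thread.structureOf, Event.label, Event.step, ha, MemOp.loc?] using hy.symm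
    subst hxy
    exact not_lt.1 fun hlt =>
      (hX.value_init i _ y hex ha hrf).1 _ _ h4 ((key_lt_key h4.1 hex).1 hlt)
  · intro i j w hw w' hw' hwk hwk' hl hne
    rw [hp] at hw hw'
    refine lt_or_gt_of_ne fun heq => hne ?_
    have h5 := key_inj hX (p := ⟨i, w.step⟩) (q := ⟨j, w'.step⟩) heq
    obtain ⟨rfl, h6⟩ := Sigma.mk.inj_iff.1 h5
    rw [hw.eq_of_step hw' (eq_of_heq h6)]
  · rintro i r hr w hw ⟨hre, hwe, hat⟩ k w' hw' hwk' hne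
    rw [hp] at hr hw hw'
    obtain ⟨y, hh', hwe', hy, h4⟩ := hw'.exec_of_write hwk' rfl
    have hrx := hr.exec_iff.2 hre
    have hwx := hw.exec_iff.2 hwe
    refine (hX.atomic i _ _ hrx hwx hat k _ y h4 ?_).imp (key_lt_key h4.1 hrx).2
      (key_lt_key hwx h4.1).2
    intro h5
    refine hne ?_
    obtain ⟨rfl, h6⟩ := Sigma.mk.inj_iff.1 h5
    rw [hw'.eq_of_step hw (eq_of_heq h6)]

theorem con_tuples (hX : X.Valid mm) (hM : P.IsPotentialMatches mm M) :
    (P.semantics mm M).Con (X.tuples M) := by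
  refine ⟨Set.Finite.image _ ?_, fun i => ?_, ?_, _, clocksConsistent_tuples hX hM⟩
  · choose own hown using fun m : M => exists_owns hM m.2
    exact Set.Finite.of_injOn (f := own) (t := Set.univ) (fun _ _ => trivial)
      (fun m hm m' hm' h => eq_of_owns hm hm' (hown m) (h ▸ hown m')) Set.finite_univ
  · rw [proj_tuples hX hM]
    exact con_occurs hX i
  · rintro _ ⟨m, hm, rfl⟩ _ ⟨m', hm', rfl⟩ i e he he' hk
    -- By the shape of `M`, a read event occurs only as the read of a pair, hence in a tuple owned
    -- by its own step.
    have howns : ∀ m : M, m.1.comp i = some e → Owns ⟨i, e.step⟩ m.1 := by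
      intro m he
      obtain ⟨j, f, hs, hf⟩ | ⟨j, r, l, w, hp, hr, hw⟩ := hM.shape m.1 m.2
      · by_cases hj : i = j
        · subst hj
          obtain rfl := Option.some.inj (he.symm.trans hs.1)
          exact absurd hk hf
        · simp [hs.2 i hj] at he
      · by_cases hj : i = j
        · subst hj
          obtain rfl := Option.some.inj (he.symm.trans hp.2.1)
          cases e <;> simp only [Event.kind, reduceCtorEq] at hr
          cases w <;> simp only [Event.kind, reduceCtorEq] at hw
          exact Or.inr ⟨_, l, _, _, hp⟩
        · by_cases hl : i = l
          · subst hl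
            obtain rfl := Option.some.inj (he.symm.trans hp.2.2.1)
            cases hk.symm.trans hw
          · simp [hp.2.2.2 i hj hl] at he
    rw [eq_of_owns hm hm' (howns m he) (howns m' he')]

/-- Tuples are sorted by the key of their owner, so a matched pair takes the position of its read.
-/
theorem exists_tuples_enumeration (hX : X.Valid mm) (hM : P.IsPotentialMatches mm M) :
    ∃ (N : ℕ) (s : Fin N → M), (P.semantics mm M).IsSecuring s ∧ Set.range s = X.tuples M := by
  choose own hown using fun m : M => exists_owns hM m.2
  suffices hen : ∀ m ∈ X.tuples M, (P.semantics mm M).Enables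
      {m' | m' ∈ X.tuples M ∧ X.key (own m').1 (own m').2 < X.key (own m).1 (own m).2} m by
    obtain ⟨N, s, hs, hr, -⟩ := EventStructure.exists_isSecuring (con_tuples hX hM)
      (fun m => X.key (own m).1 (own m).2)
      (fun m hm m' hm' h => eq_of_owns hm hm' (hown m) (key_inj hX h ▸ hown m')) hen
    exact ⟨N, s, hs, hr⟩
  intro m hm
  refine ⟨(P.semantics mm M).con_subset _ _ (fun _ h => h.1) (con_tuples hX hM), ?_, ?_⟩
  · intro i e he hk
    obtain ⟨f, hs, hf, -⟩ | ⟨hr, j, l, hl, hp⟩ := hown m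
    · by_cases hi : i = (own m).1
      · subst hi
        obtain rfl := Option.some.inj (he.symm.trans hs.1)
        exact absurd hk hf
      · simp [hs.2 i hi] at he
    · by_cases hj : i = j
      · exact ⟨(own m).1, hj ▸ hp.1, by simp [hp.2.1]⟩
      · exact ⟨j, Ne.symm hj, by simp [hp.2.2.1]⟩
  · intro i e he
    refine ⟨(P.structures mm i).con_subset _ _ (fun f hf => ?_) (con_occurs hX i),
      fun hex a ha => ?_⟩
    · obtain ⟨_, ⟨m', hm', rfl⟩, hf⟩ := hf
      exact hm'.1.1 i f hf
    · have hexec := (hm.1 i e he).exec_iff.2 hex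
      -- For the write of a pair this holds because it precedes the read in memory order; what the
      -- write needs is therefore present when the pair is placed.
      have hle : X.key i e.step ≤ X.key (own m).1 (own m).2 := by
        obtain ⟨f, hs, hf, hst⟩ | ⟨⟨x, hx⟩, j, l, hl, hp⟩ := hown m
        · by_cases hi : i = (own m).1
          · subst hi
            obtain rfl := Option.some.inj (he.symm.trans hs.1)
            rw [hst]
          · simp [hs.2 i hi] at he
        · by_cases hi : i = (own m).1
          · subst hi
            obtain rfl := Option.some.inj (he.symm.trans hp.2.1)
            rfl
          · by_cases hj : i = j
            · subst hj
              obtain rfl := Option.some.inj (he.symm.trans hp.2.2.1)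
              have hr := (hm.1 _ _ hp.2.1).1
              exact ((key_lt_key hexec hr).2 (hX.value_write _ _ x _ _ hr hx
                (hm.2 _ _ _ _ _ _ hp.2.1 hp.2.2.1)).2.1).le
            · simp [hp.2.2.2 i hi hj] at he
      obtain ⟨m', hm', ho⟩ := Execution.exists_mem_tuples hX hM ⟨i, a⟩
      obtain ⟨e', he', hs⟩ := ho.exists_comp
      refine ⟨e', ⟨m'.1, ⟨m', ⟨hm', ?_⟩, rfl⟩, he'⟩, hs⟩
      rw [(hown m').unique ho]
      exact (key_lt_of_preserved hX hexec ha).trans_le hle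

/-- Each step already has an event, and distinct events of a step conflict, so an extension can use
only occurring events. A new pairing is excluded because a read event lies in at most one tuple. -/
theorem isMaximalConfiguration_tuples (hX : X.Valid mm) (hM : P.IsPotentialMatches mm M) :
    (P.semantics mm M).IsMaximalConfiguration (X.tuples M) := by
  obtain ⟨N, s, hs, hr⟩ := exists_tuples_enumeration hX hM
  refine ⟨⟨con_tuples hX hM, hr ▸ hs.secured⟩, fun C' hC' hsub => ?_⟩
  refine Set.Subset.antisymm (fun m hm => ?_) hsub
  have hocc : ∀ i e, m.1.comp i = some e →
      X.Occurs i e ∧ ∃ m' ∈ X.tuples M, m'.1.comp i = some e := by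
    intro i e he
    obtain ⟨m', hm', ho⟩ := Execution.exists_mem_tuples hX hM ⟨i, e.step⟩
    obtain ⟨e', he', hst⟩ := ho.exists_comp
    have heq : e = e' := by
      by_contra hne
      exact (hC'.1.comp_con i).2 e ⟨m.1, ⟨m, hm, rfl⟩, he⟩ e' ⟨m'.1, ⟨m', hsub hm', rfl⟩, he'⟩
        ⟨hne, Or.inr (Or.inl hst.symm)⟩
    subst heq
    exact ⟨hm'.1 _ _ he', m', hm', he'⟩
  refine ⟨fun i e he => (hocc i e he).1, fun i k hk j l hl h1 h2 => ?_⟩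
  obtain ⟨-, m', hm', he'⟩ := hocc i _ h1
  have := hC'.1.functional m.1 ⟨m, hm, rfl⟩ m'.1 ⟨m', hsub hm', rfl⟩ i _ h1 he' rfl
  exact hm'.2 i k hk j l hl he' (this ▸ h2)

theorem isDataFlow_tuples (hX : X.Valid mm) (hM : P.IsPotentialMatches mm M) :
    IsDataFlow (X.tuples M) X.val X.ini := by
  refine ⟨hX.init, hX.ssa, fun i k => ⟨?_, fun hk => ?_⟩, ?_, ?_, ?_⟩
  · rintro ⟨m, hm, e, he, hex, rfl⟩
    exact (hm.1 i e he).exec_iff.2 hex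
  · obtain ⟨m, hm, ho⟩ := Execution.exists_mem_tuples hX hM ⟨i, k⟩
    obtain ⟨e, he, hs⟩ := ho.exists_comp
    exact ⟨m, hm, e, he, (hm.1 i e he).exec_iff.1 (by rw [hs]; exact hk), hs⟩
  · intro m hm i j k l hk hl h1 h2
    obtain ⟨x, hx⟩ := id hk
    exact (hX.value_write i k x j l (hm.1 _ _ h1).1 hx (hm.2 _ _ _ _ _ _ h1 h2)).2.2.2
  · intro m hm i k l hlk h hg h1
    obtain ⟨x, hx, -⟩ := id h
    exact (hX.value_write i k x i l (hm.1 _ _ h1).1 hx (hm.1 _ _ h1).2).2.2.2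
  · intro m hm i k h x h1 hx
    exact (hX.value_init i k x (hm.1 _ _ h1).1 hx (hm.1 _ _ h1).2).2

end Execution

/-- A linearisation is defined on all of `C`, so the per-thread domain does not depend on the choice
of `τ`. -/
theorem threadEvents_eq {C : Set M} {τ : M → Option ℕ}
    (hτ : (P.semantics mm M).IsLinearisation C τ) (i : Fin P.n) :
    threadEvents τ C i = proj (P.structures mm) i (Subtype.val '' C) := by
  ext e
  constructor
  · rintro ⟨⟨m, hm, he⟩, -⟩
    exact ⟨m.1, ⟨m, hm, rfl⟩, he⟩
  · rintro ⟨_, ⟨m, hm, rfl⟩, he⟩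
    obtain ⟨n, hn⟩ := (hτ.dom m).1 hm
    exact ⟨⟨m, hm, he⟩, _, if_pos ⟨m, n, he, hn⟩⟩

theorem exists_configuration_of_hasAssertionViolation (hM : P.IsPotentialMatches mm M)
    (h : P.HasAssertionViolation mm) :
    ∃ C : Set M, (P.semantics mm M).IsMaximalConfiguration C ∧
      ∃ τ : M → Option ℕ, (P.semantics mm M).IsLinearisation C τ ∧
        ∃ σ ini, IsDataFlow C σ ini ∧
          ∃ i, (P.structures mm i).IsConfiguration (threadEvents τ C i) ∧
            P.ContainsNegatedAssertion i (threadEvents τ C i) (σ i) := by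
  obtain ⟨X, hX, i, A, hA, hreads, hguard, hviol⟩ := h
  obtain ⟨N, s, hs, hr⟩ := Execution.exists_tuples_enumeration hX hM
  obtain ⟨τ, hτ⟩ := hs.exists_isLinearisation
  rw [hr] at hτ
  have hev := (threadEvents_eq hτ i).trans (Execution.proj_tuples hX hM i)
  refine ⟨_, Execution.isMaximalConfiguration_tuples hX hM, τ, hτ, _, _,
    Execution.isDataFlow_tuples hX hM, i, ?_, A, hA, fun k hk => ?_, hguard, hviol⟩
  · obtain ⟨N, s, hs, hr, -⟩ := Execution.exists_thread_enumeration hX hM i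
    rw [hev]
    exact ⟨Execution.con_occurs hX i, hr ▸ hs.secured⟩
  · obtain ⟨m, hm, ho⟩ := Execution.exists_mem_tuples hX hM ⟨i, k⟩
    obtain ⟨e, he, hs⟩ := ho.exists_comp
    have hocc := hm.1 i e he
    rw [hev]
    exact ⟨e, hocc, hocc.exec_iff.1 (by rw [hs]; exact hreads k hk), hs⟩

end Program

/-! ### From a configuration back to an execution -/

namespace Program

variable {Loc Val : Type*} {P : Program Loc Val} {mm : MemoryModel}
  {M : Set (ProductEvent (P.structures mm))}

open Thread (Event)

theorem _root_.Thread.Con.eq_of_step {T : Thread Loc Val} {S : Set T.Event} (hS : T.Con S)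
    {e e' : T.Event} (he : e ∈ S) (he' : e' ∈ S) (hs : e.step = e'.step) : e = e' := by
  by_contra hne
  exact hS.2 e he e' he' ⟨hne, Or.inr (Or.inl hs)⟩

/-- The trace behind the clock must decide the earlier step before it can execute the later one, and
conflict-freeness of the whole trace forces the deciding event to be `e`. -/
theorem _root_.Thread.structureOf.clock_lt {T : Thread Loc Val} {S : Set T.Event}
    {clk : T.Event → ℕ} (h : (T.structureOf mm).IsClock S clk) {e e' : T.Event} (he : e ∈ S)
    (he' : e' ∈ S) (hex : e'.Executes) (hp : T.Preserved mm e.step e'.step) : clk e < clk e' := by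
  obtain ⟨N, s, ⟨-, hcon, hen⟩, hS, hmono⟩ := h
  obtain ⟨b, rfl⟩ := hS he'
  obtain ⟨_, ⟨a, hab, rfl⟩, hs⟩ := (hen b).2 hex _ hp
  rw [← Thread.Con.eq_of_step hcon ⟨a, rfl⟩ (hS he) hs]
  exact hmono hab

theorem _root_.EventStructure.IsClock.injOn {E Lab : Type*} {Γ : EventStructure E Lab} {S : Set E}
    {clk : E → ℕ} (h : Γ.IsClock S clk) : S.InjOn clk := by
  obtain ⟨N, s, -, hS, hmono⟩ := h
  intro e he e' he' heq
  obtain ⟨a, rfl⟩ := hS he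
  obtain ⟨b, rfl⟩ := hS he'
  rw [hmono.injective heq]

/-- Steps that precede an executed one in the preserved program order are decided. -/
theorem exists_mem_proj_of_preserved {C : Set M} (hC : (P.semantics mm M).Secured C) {i : Fin P.n}
    {e : (P.thread i).Event} (he : e ∈ proj (P.structures mm) i (Subtype.val '' C))
    (hex : e.Executes) {a : Fin (P.thread i).len} (ha : (P.thread i).Preserved mm a e.step) :
    ∃ e' ∈ proj (P.structures mm) i (Subtype.val '' C), Event.step e' = a := by
  obtain ⟨_, ⟨m, hm, rfl⟩, he⟩ := he
  obtain ⟨n, s, rfl, hs⟩ := hC m hm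
  obtain ⟨e', he', hst⟩ := ((hs n le_rfl).2.2.2 i e he).2 hex a ha
  refine ⟨e', proj_mono _ (Set.image_mono ?_) he', hst⟩
  rintro _ ⟨j, hj, rfl⟩
  exact (hs j (le_of_lt hj)).1

/-- The source precedes the read at the same address, so securedness decides its step. It cannot be
skipped, since the guard of a local read includes the guard of its source. -/
theorem write_mem_proj_of_localRead {C : Set M} (hC : (P.semantics mm M).IsConfiguration C)
    {i : Fin P.n} {k l : Fin (P.thread i).len} {hlk h hg}
    (he : Event.localRead k l hlk h hg ∈ proj (P.structures mm) i (Subtype.val '' C)) (hw) :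
    Event.write l hw ∈ proj (P.structures mm) i (Subtype.val '' C) := by
  obtain ⟨x, hk, hl⟩ := id h
  obtain ⟨e', he', hs⟩ := exists_mem_proj_of_preserved hC.2 he trivial (a := l)
    ⟨hlk, by simp [Event.step, hk, hl]⟩
  cases e' with
  | write => cases hs; exact he'
  | read k' h' => cases hs; obtain ⟨y, hy⟩ := h'; cases hl.symm.trans hy
  | localRead k' _ _ h' => cases hs; obtain ⟨y, hy, _⟩ := h'; cases hl.symm.trans hy
  | initRead k' h' => cases hs; obtain ⟨y, hy⟩ := h'; cases hl.symm.trans hy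
  | fence k' h' => cases hs; cases hl.symm.trans h'
  | skip k' =>
    cases hs
    exact absurd ⟨by simp, Or.inl fun ⟨σ, _, h1, h2⟩ => h2 h1.2⟩ ((hC.1.comp_con i).2 _ he _ he')

/-- The write that the read `k` of thread `i` reads in `C`. -/
inductive ReadsFrom (C : Set M) (i : Fin P.n) (k : Fin (P.thread i).len) :
    Option (Σ j, Fin (P.thread j).len) → Prop
  | initial (h) (he : Event.initRead k h ∈ proj (P.structures mm) i (Subtype.val '' C)) :
      ReadsFrom C i k none
  | own (l hlk h hg)
      (he : Event.localRead k l hlk h hg ∈ proj (P.structures mm) i (Subtype.val '' C)) :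
      ReadsFrom C i k (some ⟨i, l⟩)
  | other (m : M) (hm : m ∈ C) (j : Fin P.n) (l : Fin (P.thread j).len) (h hl)
      (hr : m.1.comp i = some (Event.read k h)) (hw : m.1.comp j = some (Event.write l hl)) :
      ReadsFrom C i k (some ⟨j, l⟩)

/-- The only case with content is a read from another thread: `M` has no such read on its own, so
the tuple contains the write. -/
theorem exists_readsFrom (hM : P.IsPotentialMatches mm M) {C : Set M} {i : Fin P.n}
    {k : Fin (P.thread i).len} {x : Loc} (hk : (P.thread i).act k = .read x)
    {e : (P.thread i).Event} (he : e ∈ proj (P.structures mm) i (Subtype.val '' C))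
    (hex : e.Executes) (hs : e.step = k) : ∃ o, ReadsFrom C i k o := by
  subst hs
  cases e with
  | write k' h => obtain ⟨y, hy⟩ := h; cases hk.symm.trans hy
  | localRead k' l => exact ⟨_, .own _ _ _ _ he⟩
  | initRead k' h => exact ⟨_, .initial _ he⟩
  | fence k' h => cases hk.symm.trans h
  | skip => exact hex.elim
  | read k' h =>
    obtain ⟨_, ⟨m, hm, rfl⟩, he⟩ := he
    obtain ⟨j, f, hf, hkd⟩ | ⟨j, r, l, w, hp, hr, hw⟩ := hM.shape m.1 m.2
    · by_cases hj : i = j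
      · subst hj
        obtain rfl := Option.some.inj (he.symm.trans hf.1)
        exact absurd rfl hkd
      · simp [hf.2 i hj] at he
    · cases w <;> simp only [Event.kind, reduceCtorEq] at hw
      exact ⟨_, .other m hm _ _ _ _ he hp.2.2.1⟩

theorem hasAssertionViolation_of_configuration (hM : P.IsPotentialMatches mm M) {C : Set M}
    (hC : (P.semantics mm M).IsConfiguration C) {σ : ∀ i, (P.thread i).Sym → Val} {ini : Loc → Val}
    (hσ : IsDataFlow C σ ini) {i₀ : Fin P.n} {S : Set (P.thread i₀).Event}
    (hS : S ⊆ proj (P.structures mm) i₀ (Subtype.val '' C))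
    (hA : P.ContainsNegatedAssertion i₀ S (σ i₀)) : P.HasAssertionViolation mm := by
  classical
  let Q := fun i => proj (P.structures mm) i (Subtype.val '' C)
  have hcon : ∀ i, (P.thread i).Con (Q i) := hC.1.comp_con
  obtain ⟨clk, hclk⟩ := hC.1.clocks
  have hguard : ∀ i k, (∃ e ∈ Q i, e.Executes ∧ e.step = k) ↔ (P.thread i).guard k (σ i) := by
    intro i k
    rw [← hσ.guard]
    constructor
    · rintro ⟨e, ⟨_, ⟨m, hm, rfl⟩, he⟩, h⟩
      exact ⟨m, hm, e, he, h⟩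
    · rintro ⟨m, hm, e, he, h⟩
      exact ⟨e, ⟨_, ⟨m, hm, rfl⟩, he⟩, h⟩
  -- A step with false guard gets a dummy event, and below a dummy `rf`; the axioms of an execution
  -- constrain executed steps only.
  have hev : ∀ i k, ∃ e : (P.thread i).Event,
      (P.thread i).guard k (σ i) → e ∈ Q i ∧ e.Executes ∧ e.step = k := by
    intro i k
    by_cases h : (P.thread i).guard k (σ i)
    · obtain ⟨e, he⟩ := (hguard i k).2 h
      exact ⟨e, fun _ => he⟩
    · exact ⟨.skip k, fun h' => absurd h' h⟩
  choose ev hev using hev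
  have hrf : ∀ i k, ∃ o, (P.thread i).guard k (σ i) →
      (∃ x, (P.thread i).act k = .read x) → ReadsFrom C i k o := by
    intro i k
    by_cases h : (P.thread i).guard k (σ i) ∧ ∃ x, (P.thread i).act k = .read x
    · obtain ⟨hg, x, hx⟩ := h
      obtain ⟨he, hex, hs⟩ := hev i k hg
      obtain ⟨o, ho⟩ := exists_readsFrom hM hx he hex hs
      exact ⟨o, fun _ _ => ho⟩
    · exact ⟨none, fun h1 h2 => absurd ⟨h1, h2⟩ h⟩
  choose rf hrf using hrf
  let wr : ∀ i, Fin (P.thread i).len → ℕ := fun i k =>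
    if ∃ x, (P.thread i).act k = .write x then 1 else 0
  let c : ∀ i, Fin (P.thread i).len → ℕ := fun i k => clk i (ev i k)
  -- Lexicographic order on clock, then reads before writes, then thread index, coded as one number
  -- in mixed radix. The middle component matters because a read may be level with a write that it
  -- must not see.
  let time : ∀ i, Fin (P.thread i).len → ℕ := fun i k => (2 * c i k + wr i k) * P.n + i
  let X : P.Execution := ⟨σ, ini, time, rf⟩
  have hwr : ∀ i k, wr i k ≤ 1 := fun i k => by simp only [wr]; split_ifs <;> simp
  have lt_of : ∀ {i j k l}, 2 * c i k + wr i k < 2 * c j l + wr j l → time i k < time j l := by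
    intro i j k l h
    have h1 : (2 * c i k + wr i k + 1) * P.n ≤ (2 * c j l + wr j l) * P.n :=
      Nat.mul_le_mul_right _ h
    have h2 := i.2
    simp only [time]
    rw [add_mul] at h1
    omega
  have le_of : ∀ {i j k l}, time i k ≤ time j l → 2 * c i k + wr i k ≤ 2 * c j l + wr j l :=
    fun h => not_lt.1 fun h' => absurd (lt_of h') (not_lt.2 h)
  have time_lt : ∀ {i j k l}, c i k < c j l → time i k < time j l := by
    intro i j k l h
    have := hwr i k
    exact lt_of (by omega)
  have ev_eq : ∀ {i} {e : (P.thread i).Event}, e ∈ Q i → e.Executes → ev i e.step = e := by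
    intro i e he hex
    obtain ⟨h1, -, h3⟩ := hev i e.step ((hguard i _).1 ⟨e, he, hex, rfl⟩)
    exact (hcon i).eq_of_step h1 he h3
  have exec_of : ∀ {i} {e : (P.thread i).Event}, e ∈ Q i → e.Executes → X.Exec i e.step :=
    fun he hex => (hguard _ _).1 ⟨_, he, hex, rfl⟩
  have write_of : ∀ {x i k}, X.ExecWrite x i k → ∃ h, ev i k = Event.write k h := by
    rintro x i k ⟨hg, hx⟩
    obtain ⟨-, hex, hs⟩ := hev i k hg
    cases he : ev i k with
    | write k' h => rw [he] at hs; cases hs; exact ⟨_, rfl⟩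
    | read k' h => rw [he] at hs; cases hs; obtain ⟨y, hy⟩ := h; cases hx.symm.trans hy
    | localRead k' _ _ h => rw [he] at hs; cases hs; obtain ⟨y, hy, _⟩ := h; cases hx.symm.trans hy
    | initRead k' h => rw [he] at hs; cases hs; obtain ⟨y, hy⟩ := h; cases hx.symm.trans hy
    | fence k' h => rw [he] at hs; cases hs; cases hx.symm.trans h
    | skip => rw [he] at hex; exact hex.elim
  have wr_write : ∀ {x i k}, (P.thread i).act k = .write x → wr i k = 1 :=
    fun h => if_pos ⟨_, h⟩
  have wr_read : ∀ {x i k}, (P.thread i).act k = .read x → wr i k = 0 :=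
    fun h => if_neg fun ⟨_, h'⟩ => by cases h.symm.trans h'
  have label_write : ∀ {x i k h}, (P.thread i).act k = .write x →
      (P.structures mm i).label (Event.write k h) = some x := by
    intro x i k h hx
    simp [structures, Thread.structureOf, Event.label, Event.step, hx, MemOp.loc?]
  -- Transfers the "latest write" condition from clocks to time stamps, for local and matched reads
  -- alike.
  have latest : ∀ {x i k j w}, X.Exec i k → (P.thread i).act k = .read x → X.ExecWrite x j w →
      (∀ j' w', X.ExecWrite x j' w' → (⟨j', ev j' w'⟩ : Σ j, (P.thread j).Event) ≠ ⟨j, ev j w⟩ →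
        c j' w' < c i k → c j' w' < c j w) →
      ∀ j' w', X.ExecWrite x j' w' → time j' w' < time i k → time j' w' ≤ time j w := by
    intro x i k j w hk hx hw h j' w' hw' hlt
    by_cases hne : (⟨j', ev j' w'⟩ : Σ j, (P.thread j).Event) = ⟨j, ev j w⟩
    · obtain ⟨rfl, heq⟩ := Sigma.mk.inj_iff.1 hne
      obtain rfl : w' = w := by
        rw [← (hev j' w' hw'.1).2.2, ← (hev j' w hw.1).2.2, eq_of_heq heq]
      exact le_rfl
    · refine (time_lt (h j' w' hw' hne ?_)).le
      -- A write earlier in time than the read satisfies `2 * c + 1 ≤ 2 * c'`, so its clock is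
      -- strictly smaller and the clock condition applies.
      have := le_of hlt.le
      rw [wr_write hw'.2, wr_read hx] at this
      omega
  refine ⟨X, ⟨hσ.init, hσ.ssa, ?_, ?_, ?_, ?_, ?_⟩, i₀, ?_⟩
  · intro i j a b ha hb h
    -- Equal times have equal leading digits and equal thread indices; halving gives equal clocks
    -- within one thread, where clocks are injective.
    have h1 : 2 * c i a + wr i a = 2 * c j b + wr j b :=
      le_antisymm (le_of (le_of_eq h)) (le_of (le_of_eq h.symm))
    have h2 : (i : ℕ) = j := by
      simp only [X, time, h1] at h
      omega
    obtain rfl := Fin.ext h2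
    have h3 : c i a = c i b := by
      have := hwr i a
      have := hwr i b
      omega
    have h4 := (hclk.clock i).injOn (hev i a ha).1 (hev i b hb).1 h3
    rw [← (hev i a ha).2.2, ← (hev i b hb).2.2, h4]
  · intro i a b ha hb hab
    obtain ⟨h1, -, h2⟩ := hev i a ha
    obtain ⟨h3, h4, h5⟩ := hev i b hb
    exact time_lt (Thread.structureOf.clock_lt (hclk.clock i) h1 h3 h4 (by rw [h2, h5]; exact hab))
  · intro i k x j w hk hx hr
    have hread := hrf i k hk ⟨x, hx⟩
    rw [show rf i k = _ from hr] at hread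
    cases hread with
    | own w hlk h hg he =>
      obtain ⟨y, hy, hl⟩ := id h
      cases hx.symm.trans hy
      -- A local read carries no tuple containing its source, so that the write is executed has to
      -- come from securedness.
      have hwm := write_mem_proj_of_localRead hC he ⟨x, hl⟩
      have hw : X.ExecWrite x i w := ⟨exec_of hwm trivial, hl⟩
      have hevk : ev i k = _ := ev_eq he trivial
      have hevw : ev i w = _ := ev_eq hwm trivial
      have hlab : (P.structures mm i).label (Event.localRead k w hlk h hg) = some x := by
        simp [structures, Thread.structureOf, Event.label, Event.step, hx, MemOp.loc?]
      refine ⟨hw, time_lt ?_, latest hk hx hw fun j' w' hw' hne hlt => ?_, ?_⟩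
      · simp only [c]
        rw [hevk, hevw]
        exact Thread.structureOf.clock_lt (hclk.clock i) hwm he trivial
          ⟨hlk, by simp [Event.step, hx, hl]⟩
      · obtain ⟨hh, hw'e⟩ := write_of hw'
        have hmem := (hev j' w' hw'.1).1
        simp only [c] at hlt ⊢
        rw [hevk] at hlt
        rw [hevw] at hne ⊢
        rw [hw'e] at hne hlt hmem ⊢
        exact hclk.local_latest i _ he _ rfl j' _ hmem rfl
          ((label_write hw'.2).trans hlab.symm) hne hlt
      · obtain ⟨_, ⟨m, hm, rfl⟩, he⟩ := he
        exact hσ.localRead m hm i k w hlk h hg he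
    | other m hm j w h hl hrd hwt =>
      have hkm : Event.read k h ∈ Q i := ⟨m.1, ⟨m, hm, rfl⟩, hrd⟩
      have hwm : Event.write w hl ∈ Q j := ⟨m.1, ⟨m, hm, rfl⟩, hwt⟩
      have hlab : (P.structures mm i).label (Event.read k h) = some x := by
        simp [structures, Thread.structureOf, Event.label, Event.step, hx, MemOp.loc?]
      have hact : (P.thread j).act w = .write x := by
        obtain ⟨y, hy⟩ := id hl
        have := (m.1.label_eq i j _ _ hrd hwt).symm.trans hlab
        rw [label_write hy] at this
        cases this
        exact hy
      have hw : X.ExecWrite x j w := ⟨exec_of hwm trivial, hact⟩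
      have hevk : ev i k = _ := ev_eq hkm trivial
      have hevw : ev j w = _ := ev_eq hwm trivial
      refine ⟨hw, time_lt ?_, latest hk hx hw fun j' w' hw' hne hlt => ?_,
        hσ.read m hm i j k w h hl hrd hwt⟩
      · simp only [c]
        rw [hevk, hevw]
        exact hclk.no_time_travel m.1 ⟨m, hm, rfl⟩ i j _ _ hrd rfl hwt rfl
      · obtain ⟨hh, hw'e⟩ := write_of hw'
        have hmem := (hev j' w' hw'.1).1
        simp only [c] at hlt ⊢
        rw [hevk] at hlt
        rw [hevw] at hne ⊢
        rw [hw'e] at hne hlt hmem ⊢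
        exact hclk.latest m.1 ⟨m, hm, rfl⟩ i j _ _ hrd rfl hwt rfl j' _ hmem rfl
          ((label_write hw'.2).trans hlab.symm) hne hlt
  · intro i k x hk hx hr
    have hread := hrf i k hk ⟨x, hx⟩
    rw [show rf i k = _ from hr] at hread
    cases hread with
    | initial h he =>
      have hevk : ev i k = _ := ev_eq he trivial
      have hlab : (P.structures mm i).label (Event.initRead k h) = some x := by
        simp [structures, Thread.structureOf, Event.label, Event.step, hx, MemOp.loc?]
      -- The clocks give only a weak inequality here; the extra unit in the stamp of a write makes
      -- it strict.
      refine ⟨fun j' w' hw' => not_lt.2 (lt_of ?_).le, ?_⟩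
      · obtain ⟨hh, hw'e⟩ := write_of hw'
        have hmem := (hev j' w' hw'.1).1
        rw [hw'e] at hmem
        have hle := hclk.init_latest i _ he rfl j' _ hmem rfl
          ((label_write hw'.2).trans hlab.symm)
        rw [← hevk, ← hw'e] at hle
        rw [wr_write hw'.2, wr_read hx]
        change c i k ≤ c j' w' at hle
        omega
      · obtain ⟨_, ⟨m, hm, rfl⟩, he⟩ := he
        exact hσ.initRead m hm i k h x he hx
  · intro i a b ha hb hab j w x hw hne
    obtain ⟨h1, h2, h3⟩ := hev i a ha
    obtain ⟨h4, h5, h6⟩ := hev i b hb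
    obtain ⟨h7, -, h8⟩ := hev j w hw.1
    obtain ⟨hh, hwe⟩ := write_of hw
    refine (hclk.atomic i _ h1 _ h4 ⟨h2, h5, by rw [h3, h6]; exact hab⟩ j _ h7
      (by rw [hwe]; rfl) ?_).imp time_lt time_lt
    intro heq
    refine hne ?_
    obtain ⟨rfl, heq⟩ := Sigma.mk.inj_iff.1 heq
    rw [← h8, ← h6, eq_of_heq heq]
  · obtain ⟨A, hA, hreads, hg, hv⟩ := hA
    refine ⟨A, hA, fun k hk => ?_, hg, hv⟩
    obtain ⟨e, he, hex, rfl⟩ := hreads k hk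
    exact exec_of (hS he) hex

end Program

theorem theorem1 {Loc Val : Type*} (P : Program Loc Val) (mm : MemoryModel)
    (M : Set (ProductEvent (P.structures mm))) (hM : P.IsPotentialMatches mm M) :
    P.HasAssertionViolation mm ↔
      ∃ C : Set M, (P.semantics mm M).IsMaximalConfiguration C ∧
        ∃ τ : M → Option ℕ, (P.semantics mm M).IsLinearisation C τ ∧
          ∃ σ ini, Program.IsDataFlow C σ ini ∧
            ∃ i, (P.structures mm i).IsConfiguration (Program.threadEvents τ C i) ∧
              P.ContainsNegatedAssertion i (Program.threadEvents τ C i) (σ i) := by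
  refine ⟨Program.exists_configuration_of_hasAssertionViolation hM, ?_⟩
  rintro ⟨C, hC, τ, hτ, σ, ini, hσ, i, -, hA⟩
  exact Program.hasAssertionViolation_of_configuration hM hC.1 hσ
    (Program.threadEvents_eq hτ i).subset hA
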